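/- **Setting.** Let $I$ be a (strict) 2-category and let $\Sigma$ be a class of 1-cells of $I$ that contains the identities and is closed under composition and under invertible 2-cells (a *$\sigma$-pair* $(I,\Sigma)$). Write $\iota_\Sigma:\Sigma\hookrightarrow I$ for the sub-2-category with all objects of $I$, with the elements of $\Sigma$ as 1-cells, and with all 2-cells of $I$ between these. The pair $(I,\Sigma)$ is *$\sigma$-filtered* if 1. for all objects $i,i'$ there are $s:i\to i''$ and $s':i'\to i''$ in $\Sigma$; 2. for every parallel pair $d,s:i\rightrightarrows i'$ with $s\in\Sigma$ there are $t:i'\to i''$ in $\Sigma$ and a 2-cell $\alpha:td\Rightarrow ts$, which can be chosen invertible if also $d\in\Sigma$; 3. for all 2-cells $\alpha,\alpha':d\Rightarrow s$ between 1-cells $i\to i'$ with $s\in\Sigma$ there is $f:i'\to i''$ in $\Sigma$ with $f*\alpha=f*\alpha'$. A 2-category $J$ is *bifiltered* if any two objects admit 1-cells to a common object, for every parallel pair $d,d':j\rightrightarrows j'$ there are $f:j'\to j''$ and an invertible 2-cell $fd\cong fd'$, and for all parallel 2-cells $\alpha,\alpha':d\Rightarrow d'$ there is $f$ with $f*\alpha=f*\alpha'$.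 A pseudofunctor $K:J\to I$ is *$\sigma$-cofinal* with respect to classes $\Sigma'$ in $J$ and $\Sigma$ in $I$ if 1. every object $i$ of $I$ has a 1-cell $i\to K(j)$ in $\Sigma$ for some $j$; 2. for every parallel pair $d,t:i\rightrightarrows K(j)$ with $t\in\Sigma$ there are $s:j\to j'$ in $\Sigma'$ and a 2-cell $\alpha:K(s)d\Rightarrow K(s)t$, which can be chosen invertible if also $d\in\Sigma$; 3. for all 2-cells $\alpha,\alpha':d\Rightarrow t$ between 1-cells $i\to K(j)$ with $t\in\Sigma$ there is $s:j\to j'$ in $\Sigma'$ with $K(s)*\alpha=K(s)*\alpha'$. For a pseudofunctor $F:I\to\mathbf{Cat}$, a *$\sigma$-cocone* with tip $B$ is an oplax natural transformation $q:F\Rightarrow\Delta_B$ with structure 2-cells $q_d:q_jF(d)\Rightarrow q_i$ for $d:i\to j$, invertible whenever $d\in\Sigma$; $\sigma$-cocones with tip $B$ and modifications form a category. A *$\sigma$-bicolimit* $\Sigma\text{-}\mathrm{bicolim}_I F$ is a category $L$ with a $\sigma$-cocone $q:F\Rightarrow\Delta_L$ such that for every $B$ whiskering with $q$ is an equivalence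 from $\mathbf{Cat}[L,B]$ to the category of $\sigma$-cocones on $F$ with tip $B$. The (ordinary, conical) *bicolimit* is the case where $\Sigma$ consists of all 1-cells, so that all structure 2-cells are invertible. **Theorem.** Let $(I,\Sigma)$ be a $\sigma$-pair. (a) $(I,\Sigma)$ is $\sigma$-filtered if and only if the 2-category $\Sigma$ is bifiltered and the inclusion $\iota_\Sigma:\Sigma\hookrightarrow I$ is $\sigma$-cofinal with respect to the class of all 1-cells of $\Sigma$ and the class $\Sigma$ in $I$. (b) Suppose $I$ is small and $(I,\Sigma)$ is $\sigma$-filtered, and let $F:I\to\mathbf{Cat}$ be a pseudofunctor to small categories. Then the $\sigma$-bicolimit of $F$ and the bicolimit of $F\iota_\Sigma$ exist, and there is an equivalence of categories $$\mathrm{bicolim}_{\Sigma}\,F\iota_\Sigma\;\simeq\;\Sigma\text{-}\mathrm{bicolim}_{I}\,F$$ which is compatible, up to invertible modification, with the universal pseudococone on $F\iota_\Sigma$ and the restriction to $\Sigma$ of the universal $\sigma$-cocone on $F$. In particular, by (a), $\sigma$-filtered $\sigma$-bicolimits of categories are bifiltered bicolimits. -/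

import Mathlib

open CategoryTheory Bicategory

universe w v u w₂ v₂ u₂ w₃ v₃ u₃ t

namespace SigmaTwoCat

/-! ### Marked 2-categories and the sub-2-category of marked arrows -/

section Pairs

variable (I : Type u) [Bicategory.{w, v} I]

/-- A class `Σ` of 1-cells making `(I, Σ)` a `σ`-pair: it contains the identities and is closed
under composition and under invertible 2-cells. -/
structure SigmaClass where
  /-- The underlying class of 1-cells. -/
  mem : MorphismProperty I
  id_mem (i : I) : mem (𝟙 i)
  comp_mem {i j k : I} (f : i ⟶ j) (g : j ⟶ k) : mem f → mem g → mem (f ≫ g)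
  of_iso {i j : I} {f g : i ⟶ j} : (f ≅ g) → mem f → mem g

variable {I}

/-- The objects of the sub-2-category `Σ` of `I`: the same as those of `I`. -/
@[ext]
structure Sub (S : SigmaClass I) where
  /-- The underlying object of `I`. -/
  obj : I

namespace Sub

variable {S : SigmaClass I}

/-- The 1-cells of the sub-2-category `Σ`: the 1-cells of `I` that lie in `Σ`. -/
@[ext]
structure Hom (X Y : Sub S) where
  /-- The underlying 1-cell of `I`. -/
  hom : X.obj ⟶ Y.obj
  mem : S.mem hom

@[simps id_hom comp_hom]
instance categoryStruct : CategoryStruct (Sub S) where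
  Hom X Y := Hom X Y
  id X := ⟨𝟙 X.obj, S.id_mem _⟩
  comp f g := ⟨f.hom ≫ g.hom, S.comp_mem _ _ f.mem g.mem⟩

@[ext]
lemma hom_ext {X Y : Sub S} {f g : X ⟶ Y} (h : f.hom = g.hom) : f = g :=
  Hom.ext h

/-- The 2-cells of the sub-2-category `Σ`: all 2-cells of `I` between 1-cells in `Σ`. -/
@[ext]
structure Hom₂ {X Y : Sub S} (f g : X ⟶ Y) where
  /-- The underlying 2-cell of `I`. -/
  hom : f.hom ⟶ g.hom

@[simps!]
instance homCategory (X Y : Sub S) : Category (X ⟶ Y) where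
  Hom f g := Hom₂ f g
  id f := ⟨𝟙 f.hom⟩
  comp a b := ⟨a.hom ≫ b.hom⟩

@[ext]
lemma hom₂_ext {X Y : Sub S} {f g : X ⟶ Y} {a b : f ⟶ g} (h : a.hom = b.hom) : a = b :=
  Hom₂.ext h

/-- An invertible 2-cell of `I` between 1-cells in `Σ` is an invertible 2-cell of `Σ`. -/
@[simps!]
def isoMk {X Y : Sub S} {f g : X ⟶ Y} (e : f.hom ≅ g.hom) : f ≅ g where
  hom := ⟨e.hom⟩
  inv := ⟨e.inv⟩

/-- The sub-2-category `Σ` of `I`, full on objects and 2-cells, with only `Σ` as 1-cells. -/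
@[simps!]
instance bicategory : Bicategory (Sub S) where
  homCategory X Y := Sub.homCategory X Y
  whiskerLeft f _ _ a := Hom₂.mk (f.hom ◁ Hom₂.hom a)
  whiskerRight a h := Hom₂.mk (Hom₂.hom a ▷ h.hom)
  associator f g h := isoMk (α_ f.hom g.hom h.hom)
  leftUnitor f := isoMk (λ_ f.hom)
  rightUnitor f := isoMk (ρ_ f.hom)
  whisker_exchange {_ _ _ _ _ _ _} a b := by ext; exact whisker_exchange _ _

attribute [-simp] bicategory_comp_hom bicategory_Hom

@[simp]
lemma eqToHom_hom {X Y : Sub S} {f g : X ⟶ Y} (h : f = g) :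
    (eqToHom h).hom = eqToHom (h ▸ rfl) := by
  subst h; rfl

attribute [local simp] Strict.leftUnitor_eqToIso Strict.rightUnitor_eqToIso
  Strict.associator_eqToIso in
instance [Strict I] : Strict (Sub S) where

end Sub

/-- The inclusion `Σ ↪ I`. -/
@[simps]
def SigmaClass.incl (S : SigmaClass I) : Sub S ⥤ᵖ I where
  obj X := X.obj
  map f := f.hom
  map₂ a := a.hom
  mapId _ := Iso.refl _
  mapComp _ _ := Iso.refl _

end Pairs

/-! ### Filteredness and cofinality -/

section Filtered

variable {I : Type u} [Bicategory.{w, v} I] {J : Type u₂} [Bicategory.{w₂, v₂} J]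

/-- `(I, Σ)` is a `σ`-filtered pair (`d ≫ t` is the composite `td`, `α ▷ f` is the whiskering
`f * α`). -/
structure IsSigmaFiltered (S : MorphismProperty I) : Prop where
  cocone_objs (i i' : I) : ∃ (i'' : I) (s : i ⟶ i'') (s' : i' ⟶ i''), S s ∧ S s'
  cocone_maps {i i' : I} (d s : i ⟶ i') : S s →
    ∃ (i'' : I) (t : i' ⟶ i''), S t ∧ ∃ α : d ≫ t ⟶ s ≫ t, S d → IsIso α
  cocone_cells {i i' : I} {d s : i ⟶ i'} (α α' : d ⟶ s) : S s →
    ∃ (i'' : I) (f : i' ⟶ i''), S f ∧ α ▷ f = α' ▷ f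

variable (I) in
/-- The 2-category `I` is bifiltered. -/
structure IsBifiltered : Prop where
  cocone_objs (i i' : I) : ∃ i'' : I, Nonempty (i ⟶ i'') ∧ Nonempty (i' ⟶ i'')
  cocone_maps {i i' : I} (d d' : i ⟶ i') :
    ∃ (i'' : I) (f : i' ⟶ i''), Nonempty (d ≫ f ≅ d' ≫ f)
  cocone_cells {i i' : I} {d d' : i ⟶ i'} (α α' : d ⟶ d') :
    ∃ (i'' : I) (f : i' ⟶ i''), α ▷ f = α' ▷ f

/-- The pseudofunctor `F : I → J` is `σ`-cofinal with respect to the classes `S` of 1-cells of `I`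
and `S'` of 1-cells of `J`. (That `(I, S)` is `σ`-filtered is not part of this predicate.) -/
structure IsSigmaCofinal (F : I ⥤ᵖ J) (S : MorphismProperty I) (S' : MorphismProperty J) :
    Prop where
  exists_map (j : J) : ∃ (i : I) (s : j ⟶ F.obj i), S' s
  cocone_maps {j : J} {i : I} (d t : j ⟶ F.obj i) : S' t →
    ∃ (i' : I) (s : i ⟶ i'), S s ∧ ∃ α : d ≫ F.map s ⟶ t ≫ F.map s, S' d → IsIso α
  cocone_cells {j : J} {i : I} {d t : j ⟶ F.obj i} (α α' : d ⟶ t) : S' t →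
    ∃ (i' : I) (s : i ⟶ i'), S s ∧ α ▷ F.map s = α' ▷ F.map s

end Filtered

/-! ### Cocones, `σ`-bicolimits and bicolimits -/

section Cocones

variable {I : Type u} [Bicategory.{w, v} I] {C : Type u₂} [Bicategory.{w₂, v₂} C]

/-- A `σ`-cocone with tip `B` on `F : I → C`, relatively to `S`: an oplax natural transformation
`q : F ⇒ Δ_B`, with legs `q_i : F(i) → B` and oplax naturality triangles `q_d : q_j F(d) ⇒ q_i`
for `d : i → j`, which are invertible whenever `d` is in `S`. -/
structure SigmaCocone (F : I ⥤ᵖ C) (S : MorphismProperty I) (B : C) where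
  /-- The legs. -/
  leg (i : I) : F.obj i ⟶ B
  /-- The oplax naturality triangles. -/
  cell {i j : I} (d : i ⟶ j) : F.map d ≫ leg j ⟶ leg i
  cell_naturality {i j : I} {d e : i ⟶ j} (α : d ⟶ e) :
    F.map₂ α ▷ leg j ≫ cell e = cell d
  cell_id (i : I) : cell (𝟙 i) = (F.mapId i).hom ▷ leg i ≫ (λ_ (leg i)).hom
  cell_comp {i j k : I} (d : i ⟶ j) (e : j ⟶ k) :
    cell (d ≫ e) =
      (F.mapComp d e).hom ▷ leg k ≫ (α_ _ _ _).hom ≫ F.map d ◁ cell e ≫ cell d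
  isIso_cell {i j : I} (d : i ⟶ j) : S d → IsIso (cell d)

namespace SigmaCocone

variable {F : I ⥤ᵖ C} {S : MorphismProperty I}

/-- The morphisms of `σ`-cocones with tip `B` are the modifications. -/
@[ext]
structure Hom {B : C} (p q : SigmaCocone F S B) where
  /-- The components of the modification. -/
  app (i : I) : p.leg i ⟶ q.leg i
  naturality {i j : I} (d : i ⟶ j) : F.map d ◁ app j ≫ q.cell d = p.cell d ≫ app i

/-- The category of `σ`-cocones on `F` with tip `B`. -/
@[simps! id_app comp_app]
instance category (B : C) : Category (SigmaCocone F S B) where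
  Hom := Hom
  id p := { app i := 𝟙 (p.leg i), naturality := by intros; simp }
  comp a b :=
    { app i := a.app i ≫ b.app i
      naturality d := by
        rw [Bicategory.whiskerLeft_comp, Category.assoc, b.naturality, ← Category.assoc,
          a.naturality, Category.assoc] }

@[ext]
lemma hom_ext {B : C} {p q : SigmaCocone F S B} {a b : p ⟶ q} (h : ∀ i, a.app i = b.app i) :
    a = b :=
  Hom.ext (funext h)

/-- Whiskering a `σ`-cocone with tip `L` with a 1-cell `G : L → B`. -/
@[simps]
abbrev whisker {L : C} (q : SigmaCocone F S L) {B : C} (G : L ⟶ B) : SigmaCocone F S B where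
  leg i := q.leg i ≫ G
  cell d := (α_ _ _ _).inv ≫ q.cell d ▷ G
  cell_naturality α := by
    rw [← q.cell_naturality α]; simp
  cell_id i := by
    rw [q.cell_id]; simp
  cell_comp d e := by
    rw [q.cell_comp]; simp
  isIso_cell d hd := by
    have := q.isIso_cell d hd
    infer_instance

/-- The functor `C[L, B] → σCocone(F, B)` given by whiskering a `σ`-cocone with tip `L`. -/
@[simps]
def whiskerFunctor {L : C} (q : SigmaCocone F S L) (B : C) : (L ⟶ B) ⥤ SigmaCocone F S B where
  obj G := q.whisker G
  map β :=
    { app i := q.leg i ◁ β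
      naturality d := by
        rw [associator_inv_naturality_right_assoc, whisker_exchange, Category.assoc] }

/-- The restriction of a `σ`-cocone along a pseudofunctor `K : J → I`. -/
@[simps]
abbrev restrict {J : Type u₃} [Bicategory.{w₃, v₃} J] {B : C} (q : SigmaCocone F S B)
    (K : J ⥤ᵖ I) (S' : MorphismProperty J) (h : ∀ ⦃i j : J⦄ (d : i ⟶ j), S' d → S (K.map d)) :
    SigmaCocone (K.comp F) S' B where
  leg j := q.leg (K.obj j)
  cell d := q.cell (K.map d)
  cell_naturality α := q.cell_naturality (K.map₂ α)
  cell_id j := by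
    rw [← q.cell_naturality (K.mapId j).hom, q.cell_id, ← comp_whiskerRight_assoc]
    rfl
  cell_comp d e := by
    rw [← q.cell_naturality (K.mapComp d e).hom, q.cell_comp, ← comp_whiskerRight_assoc]
    rfl
  isIso_cell d hd := q.isIso_cell _ (h d hd)

/-- The `σ`-cocone `q : F ⇒ Δ_L` exhibits `L` as the `σ`-bicolimit of `F` relatively to `S`:
whiskering with `q` is an equivalence of categories `C[L, B] ≃ σCocone(F, B)` for every `B`. -/
def IsSigmaBicolimit {L : C} (q : SigmaCocone F S L) : Prop :=
  ∀ B : C, (q.whiskerFunctor B).IsEquivalence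

end SigmaCocone

/-- A pseudococone with tip `B` on `F : I → C`: a pseudonatural transformation `F ⇒ Δ_B`. -/
abbrev PseudoCocone (F : I ⥤ᵖ C) (B : C) := SigmaCocone F ⊤ B

/-- The pseudococone `r : F ⇒ Δ_M` exhibits `M` as the (conical) bicolimit of `F`. -/
abbrev PseudoCocone.IsBicolimit {F : I ⥤ᵖ C} {M : C} (r : PseudoCocone F M) : Prop :=
  SigmaCocone.IsSigmaBicolimit r

end Cocones

end SigmaTwoCat

namespace SigmaTwoCat

/-! ### Filtered pairs, bifilteredness of the marked arrows and cofinality of the inclusion -/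

section Filtered

variable {I : Type u} [Bicategory.{w, v} I] {S : SigmaClass I}

/-! Part (a) is an unwinding: common targets come from bifilteredness, and the conditions on pairs
and 2-cells with only the target 1-cell marked come from cofinality of `S.incl`.

Part (b) rests on `isEquivalence_restrictIncl`: for every tip, restriction to the marked 1-cells is
an equivalence from σ-cocones on `F` to pseudococones on its restriction. Given any 1-cell `d`,
filteredness provides marked `a`, `b` and a 2-cell `α : d ≫ b ⟶ a`. The cocone axioms force the
pasting of the triangles at `d` and `b` to be the triangle at `a` preceded by `F.map₂ α`. Since the
triangle at `b` is invertible, this equation (`IsCompatible`) determines the triangle at `d` from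
the marked ones, and it can be used to define it. Independence of `(a, b, α)` is
`IsCompatible.change`, the only place where all three filteredness axioms meet.

Hence a σ-bicolimit of `F` restricts to a bicolimit on the marked 1-cells. Existence is by
generators and relations (`Presented.isSigmaBicolimit_cocone`), and the comparison 1-cell is an
equivalence by a Yoneda argument (`isEquivalence_of_precomp`). -/

theorem IsSigmaFiltered.isBifiltered_sub (h : IsSigmaFiltered S.mem) : IsBifiltered (Sub S) where
  cocone_objs i i' := by
    obtain ⟨k, s, s', hs, hs'⟩ := h.cocone_objs i.obj i'.obj
    exact ⟨⟨k⟩, ⟨⟨s, hs⟩⟩, ⟨⟨s', hs'⟩⟩⟩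
  cocone_maps d d' := by
    obtain ⟨k, t, ht, α, hα⟩ := h.cocone_maps d.hom d'.hom d'.mem
    have := hα d.mem
    exact ⟨⟨k⟩, ⟨t, ht⟩, ⟨Sub.isoMk (asIso α)⟩⟩
  cocone_cells {_ _ _ d'} α α' := by
    obtain ⟨k, f, hf, e⟩ := h.cocone_cells α.hom α'.hom d'.mem
    exact ⟨⟨k⟩, ⟨f, hf⟩, Sub.hom₂_ext e⟩

theorem IsSigmaFiltered.isSigmaCofinal_incl (h : IsSigmaFiltered S.mem) :
    IsSigmaCofinal S.incl ⊤ S.mem where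
  exists_map j := ⟨⟨j⟩, 𝟙 j, S.id_mem j⟩
  cocone_maps d t ht := by
    obtain ⟨k, s, hs, α, hα⟩ := h.cocone_maps d t ht
    exact ⟨⟨k⟩, ⟨s, hs⟩, trivial, α, hα⟩
  cocone_cells α α' ht := by
    obtain ⟨k, s, hs, e⟩ := h.cocone_cells α α' ht
    exact ⟨⟨k⟩, ⟨s, hs⟩, trivial, e⟩

theorem IsSigmaFiltered.of_isBifiltered_of_isSigmaCofinal (h : IsBifiltered (Sub S))
    (h' : IsSigmaCofinal S.incl ⊤ S.mem) : IsSigmaFiltered S.mem where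
  cocone_objs i i' := by
    obtain ⟨k, ⟨s⟩, ⟨s'⟩⟩ := h.cocone_objs ⟨i⟩ ⟨i'⟩
    exact ⟨k.obj, s.hom, s'.hom, s.mem, s'.mem⟩
  cocone_maps {_ i'} d s hs := by
    obtain ⟨k, t, -, α, hα⟩ := h'.cocone_maps (i := ⟨i'⟩) d s hs
    exact ⟨k.obj, t.hom, t.mem, α, hα⟩
  cocone_cells {_ i' _ _} α α' hs := by
    obtain ⟨k, t, -, e⟩ := h'.cocone_cells (i := ⟨i'⟩) α α' hs
    exact ⟨k.obj, t.hom, t.mem, e⟩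

theorem isSigmaFiltered_iff :
    IsSigmaFiltered S.mem ↔ IsBifiltered (Sub S) ∧ IsSigmaCofinal S.incl ⊤ S.mem :=
  ⟨fun h => ⟨h.isBifiltered_sub, h.isSigmaCofinal_incl⟩,
    fun h => .of_isBifiltered_of_isSigmaCofinal h.1 h.2⟩

namespace IsSigmaFiltered

/-- Every 1-cell `d` becomes comparable with a marked 1-cell after composing with a marked 1-cell
extending a given one. -/
theorem exists_extension (h : IsSigmaFiltered S.mem) {i j l : I} (d : i ⟶ j) (a : j ⟶ l) :
    ∃ (m : I) (c : l ⟶ m) (b : i ⟶ m), S.mem c ∧ S.mem b ∧ Nonempty (d ≫ a ≫ c ⟶ b) := by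
  obtain ⟨k, s, s', hs, hs'⟩ := h.cocone_objs i l
  -- Only the target `s` has to be marked, so `d` and `a` may be arbitrary.
  obtain ⟨m, t, ht, α, -⟩ := h.cocone_maps (d ≫ a ≫ s') s hs
  exact ⟨m, s' ≫ t, s ≫ t, S.comp_mem _ _ hs' ht, S.comp_mem _ _ hs ht,
    ⟨d ◁ (α_ a s' t).inv ≫ (α_ d (a ≫ s') t).inv ≫ α⟩⟩

/-- Two spans of marked 1-cells can be completed to squares that commute up to 2-cells. -/
theorem exists_squares (h : IsSigmaFiltered S.mem) {i j l l' : I} {a : i ⟶ l} {b : j ⟶ l}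
    {a' : i ⟶ l'} {b' : j ⟶ l'} (ha' : S.mem a') (hb : S.mem b) :
    ∃ (m : I) (c : l ⟶ m) (c' : l' ⟶ m), S.mem c ∧ S.mem c' ∧
      Nonempty (a ≫ c ⟶ a' ≫ c') ∧ Nonempty (b' ≫ c' ⟶ b ≫ c) := by
  obtain ⟨k, s, s', hs, hs'⟩ := h.cocone_objs l l'
  obtain ⟨n, t, ht, α, -⟩ := h.cocone_maps (a ≫ s) (a' ≫ s') (S.comp_mem _ _ ha' hs')
  -- The second comparison runs in the opposite direction, with its target on the `b` side; it is
  -- made after `t`, so that the first one survives whiskering by `u`.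
  obtain ⟨m, u, hu, β, -⟩ := h.cocone_maps (b' ≫ s' ≫ t) (b ≫ s ≫ t)
    (S.comp_mem _ _ hb (S.comp_mem _ _ hs ht))
  refine ⟨m, (s ≫ t) ≫ u, (s' ≫ t) ≫ u, S.comp_mem _ _ (S.comp_mem _ _ hs ht) hu,
    S.comp_mem _ _ (S.comp_mem _ _ hs' ht) hu, ⟨?_⟩, ⟨?_⟩⟩
  · exact (α_ _ _ _).inv ≫ ((α_ _ _ _).inv ≫ α ≫ (α_ _ _ _).hom) ▷ u ≫ (α_ _ _ _).hom
  · exact (α_ _ _ _).inv ≫ β ≫ (α_ _ _ _).hom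

end IsSigmaFiltered

end Filtered

/-! ### Pasting triangles -/

section PasteCell

variable {I : Type u} [Bicategory.{w, v} I] {C : Type u₂} [Bicategory.{w₂, v₂} C]
  {F : I ⥤ᵖ C} {B : C}

/-- The pasting of two triangles over `B` along the composition constraint of `F`. -/
def pasteCell {i j k : I} {d : i ⟶ j} {e : j ⟶ k} {x : F.obj i ⟶ B} {y : F.obj j ⟶ B}
    {z : F.obj k ⟶ B} (φ : F.map d ≫ y ⟶ x) (ψ : F.map e ≫ z ⟶ y) : F.map (d ≫ e) ≫ z ⟶ x :=
  (F.mapComp d e).hom ▷ z ≫ (α_ _ _ _).hom ≫ F.map d ◁ ψ ≫ φ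

variable {i j k l : I} {x x' : F.obj i ⟶ B} {y y' : F.obj j ⟶ B} {z z' : F.obj k ⟶ B}
  {t : F.obj l ⟶ B}

/-- The axiom `cell_comp` says that the triangle at `d ≫ e` is `pasteCell (cell d) (cell e)`. This
lemma and the following ones let cocone identities be manipulated without unfolding the constraints
of `F`. -/
theorem map₂_whiskerRight_pasteCell_left {d d' : i ⟶ j} {e : j ⟶ k} (α : d ⟶ d')
    (φ : F.map d' ≫ y ⟶ x) (ψ : F.map e ≫ z ⟶ y) :
    F.map₂ (α ▷ e) ▷ z ≫ pasteCell φ ψ = pasteCell (F.map₂ α ▷ y ≫ φ) ψ := by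
  simp [pasteCell, whisker_exchange_assoc]

theorem map₂_whiskerRight_pasteCell_right {d : i ⟶ j} {e e' : j ⟶ k} (α : e ⟶ e')
    (φ : F.map d ≫ y ⟶ x) (ψ : F.map e' ≫ z ⟶ y) :
    F.map₂ (d ◁ α) ▷ z ≫ pasteCell φ ψ = pasteCell φ (F.map₂ α ▷ z ≫ ψ) := by
  simp [pasteCell]

theorem map₂_associator_pasteCell {d : i ⟶ j} {e : j ⟶ k} {f : k ⟶ l}
    (φ : F.map d ≫ y ⟶ x) (ψ : F.map e ≫ z ⟶ y) (χ : F.map f ≫ t ⟶ z) :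
    F.map₂ (α_ d e f).hom ▷ t ≫ pasteCell φ (pasteCell ψ χ) = pasteCell (pasteCell φ ψ) χ := by
  simp [pasteCell, whisker_exchange_assoc]

theorem map₂_associator_inv_pasteCell {d : i ⟶ j} {e : j ⟶ k} {f : k ⟶ l}
    (φ : F.map d ≫ y ⟶ x) (ψ : F.map e ≫ z ⟶ y) (χ : F.map f ≫ t ⟶ z) :
    F.map₂ (α_ d e f).inv ▷ t ≫ pasteCell (pasteCell φ ψ) χ = pasteCell φ (pasteCell ψ χ) := by
  rw [← map₂_associator_pasteCell, ← comp_whiskerRight_assoc, ← F.map₂_comp]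
  simp

theorem pasteCell_comp {d : i ⟶ j} {e : j ⟶ k} (φ : F.map d ≫ y ⟶ x) (ψ : F.map e ≫ z ⟶ y)
    (β : x ⟶ x') : pasteCell (φ ≫ β) ψ = pasteCell φ ψ ≫ β := by
  simp [pasteCell]

theorem pasteCell_whiskerLeft_comp {d : i ⟶ j} {e : j ⟶ k} (φ : F.map d ≫ y' ⟶ x)
    (ψ : F.map e ≫ z ⟶ y) (β : y ⟶ y') :
    pasteCell (F.map d ◁ β ≫ φ) ψ = pasteCell φ (ψ ≫ β) := by
  simp [pasteCell]

theorem whiskerLeft_pasteCell {d : i ⟶ j} {e : j ⟶ k} (φ : F.map d ≫ y ⟶ x)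
    (ψ : F.map e ≫ z' ⟶ y) (β : z ⟶ z') :
    pasteCell φ (F.map e ◁ β ≫ ψ) = F.map (d ≫ e) ◁ β ≫ pasteCell φ ψ := by
  simp [pasteCell, whisker_exchange_assoc]

/-- Everything composed before `φ` is invertible: the constraint of `F`, the associator and the
whiskering of `ψ`. -/
theorem pasteCell_left_injective {d : i ⟶ j} {e : j ⟶ k} (ψ : F.map e ≫ z ⟶ y) [IsIso ψ] :
    Function.Injective fun φ : F.map d ≫ y ⟶ x => pasteCell φ ψ := fun φ φ' h => by
  exact (cancel_epi _).1 ((cancel_epi _).1 ((cancel_epi _).1 h))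

theorem pasteCell_left_surjective {d : i ⟶ j} {e : j ⟶ k} (ψ : F.map e ≫ z ⟶ y) [IsIso ψ] :
    Function.Surjective fun φ : F.map d ≫ y ⟶ x => pasteCell φ ψ := fun χ =>
  ⟨F.map d ◁ inv ψ ≫ (α_ _ _ _).inv ≫ (F.mapComp d e).inv ▷ z ≫ χ, by
    simp [pasteCell, ← Bicategory.whiskerLeft_comp_assoc, ← comp_whiskerRight_assoc]⟩

end PasteCell

/-! ### Extension of pseudococones on the marked arrows -/

section Extension

variable {I : Type u} [Bicategory.{w, v} I] {C : Type u₂} [Bicategory.{w₂, v₂} C]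
  {F : I ⥤ᵖ C} {S : SigmaClass I} {B : C}

namespace PseudoCocone

variable (p : PseudoCocone (S.incl.comp F) B)

/-- The leg at `i` of a pseudococone on the restriction of `F` to the marked arrows. -/
def inclLeg (i : I) : F.obj i ⟶ B := p.leg ⟨i⟩

/-- The triangle at a marked 1-cell `a` of a pseudococone on the restriction of `F`. -/
def inclCell {i j : I} (a : i ⟶ j) (ha : S.mem a) : F.map a ≫ p.inclLeg j ⟶ p.inclLeg i :=
  p.cell (i := ⟨i⟩) (j := ⟨j⟩) ⟨a, ha⟩

instance {i j : I} (a : i ⟶ j) (ha : S.mem a) : IsIso (p.inclCell a ha) :=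
  p.isIso_cell _ trivial

theorem inclCell_naturality {i j : I} {a b : i ⟶ j} (ha : S.mem a) (hb : S.mem b) (α : a ⟶ b) :
    F.map₂ α ▷ p.inclLeg j ≫ p.inclCell b hb = p.inclCell a ha :=
  p.cell_naturality (i := ⟨i⟩) (j := ⟨j⟩) (d := ⟨a, ha⟩) (e := ⟨b, hb⟩) ⟨α⟩

theorem inclCell_id (i : I) :
    p.inclCell (𝟙 i) (S.id_mem i) =
      (F.mapId i).hom ▷ p.inclLeg i ≫ (λ_ (p.inclLeg i)).hom := by
  -- The unit constraint of `S.incl.comp F` carries an extra `F.map₂` of an identity, coming from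
  -- the trivial constraint of `S.incl`.
  have h : F.map₂ (𝟙 (𝟙 i)) ≫ (F.mapId i).hom = (F.mapId i).hom := by simp
  exact (p.cell_id ⟨i⟩).trans
    (congrArg (fun θ => θ ▷ p.inclLeg i ≫ (λ_ (p.inclLeg i)).hom) h)

theorem inclCell_comp {i j k : I} (a : i ⟶ j) (b : j ⟶ k) (ha : S.mem a) (hb : S.mem b) :
    p.inclCell (a ≫ b) (S.comp_mem _ _ ha hb) = pasteCell (p.inclCell a ha) (p.inclCell b hb) := by
  have h : F.map₂ (𝟙 (a ≫ b)) ≫ (F.mapComp a b).hom = (F.mapComp a b).hom := by simp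
  exact (p.cell_comp (i := ⟨i⟩) (j := ⟨j⟩) (k := ⟨k⟩) ⟨a, ha⟩ ⟨b, hb⟩).trans
    (congrArg (fun θ => θ ▷ p.inclLeg k ≫ (α_ (F.map a) (F.map b) (p.inclLeg k)).hom ≫
      F.map a ◁ p.inclCell b hb ≫ p.inclCell a ha) h)

/-- `φ` is compatible with the triangles of `p` along the 2-cell `α : d ≫ b ⟶ a`. -/
def IsCompatible {i j l : I} {d : i ⟶ j} (φ : F.map d ≫ p.inclLeg j ⟶ p.inclLeg i) {a : i ⟶ l}
    {b : j ⟶ l} (ha : S.mem a) (hb : S.mem b) (α : d ≫ b ⟶ a) : Prop :=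
  pasteCell φ (p.inclCell b hb) = F.map₂ α ▷ p.inclLeg l ≫ p.inclCell a ha

variable {p}

theorem IsCompatible.unique {i j l : I} {d : i ⟶ j} {φ φ' : F.map d ≫ p.inclLeg j ⟶ p.inclLeg i}
    {a : i ⟶ l} {b : j ⟶ l} {ha : S.mem a} {hb : S.mem b} {α : d ≫ b ⟶ a}
    (h : p.IsCompatible φ ha hb α) (h' : p.IsCompatible φ' ha hb α) : φ = φ' :=
  pasteCell_left_injective (p.inclCell b hb) (h.trans h'.symm)

/-- Triangles at marked composites are pastings, so both sides of the whiskered equation are those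
of the original one pasted with the invertible triangle at `c`, which can be cancelled. -/
theorem isCompatible_whiskerRight_iff {i j l m : I} {d : i ⟶ j}
    {φ : F.map d ≫ p.inclLeg j ⟶ p.inclLeg i} {a : i ⟶ l} {b : j ⟶ l} {ha : S.mem a}
    {hb : S.mem b} {α : d ≫ b ⟶ a} {c : l ⟶ m} (hc : S.mem c) :
    p.IsCompatible φ (S.comp_mem _ _ ha hc) (S.comp_mem _ _ hb hc) ((α_ d b c).inv ≫ α ▷ c) ↔
      p.IsCompatible φ ha hb α := by
  rw [IsCompatible, IsCompatible, p.inclCell_comp, p.inclCell_comp, F.map₂_comp,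
    comp_whiskerRight_assoc, map₂_whiskerRight_pasteCell_left, ← map₂_associator_inv_pasteCell,
    cancel_epi]
  exact (pasteCell_left_injective (p.inclCell c hc)).eq_iff

theorem IsCompatible.comp_comp {i j l : I} {d : i ⟶ j}
    {φ : F.map d ≫ p.inclLeg j ⟶ p.inclLeg i} {a a' : i ⟶ l} {b b' : j ⟶ l} {ha : S.mem a}
    {hb : S.mem b} {α : d ≫ b ⟶ a} (h : p.IsCompatible φ ha hb α) (ha' : S.mem a')
    (hb' : S.mem b') (β : b' ⟶ b) (γ : a ⟶ a') :
    p.IsCompatible φ ha' hb' (d ◁ β ≫ α ≫ γ) := by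
  rw [IsCompatible, ← p.inclCell_naturality hb' hb β, ← map₂_whiskerRight_pasteCell_right,
    F.map₂_comp, F.map₂_comp, comp_whiskerRight, comp_whiskerRight, Category.assoc, Category.assoc,
    p.inclCell_naturality ha ha' γ, ← h]

/-- Independence of the comparison data: any two comparisons of `d` with marked 1-cells become equal
after moving one along squares to the endpoints of the other and whiskering with a marked 1-cell,
and compatibility is preserved and reflected throughout. -/
theorem IsCompatible.change (hS : IsSigmaFiltered S.mem) {i j l l' : I} {d : i ⟶ j}
    {φ : F.map d ≫ p.inclLeg j ⟶ p.inclLeg i} {a : i ⟶ l} {b : j ⟶ l} {ha : S.mem a}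
    {hb : S.mem b} {α : d ≫ b ⟶ a} (h : p.IsCompatible φ ha hb α) {a' : i ⟶ l'} {b' : j ⟶ l'}
    (ha' : S.mem a') (hb' : S.mem b') (α' : d ≫ b' ⟶ a') : p.IsCompatible φ ha' hb' α' := by
  -- The opposite directions of `γ` and `δ` turn `α` into a 2-cell `d ≫ b' ≫ c' ⟶ a' ≫ c'`, parallel
  -- to the whiskering of `α'`. Invertibility is not needed, as triangles are natural in all
  -- 2-cells.
  obtain ⟨m, c, c', hc, hc', ⟨γ⟩, ⟨δ⟩⟩ := hS.exists_squares (a := a) (b' := b') ha' hb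
  have hac := S.comp_mem _ _ ha' hc'
  have hbc := S.comp_mem _ _ hb' hc'
  have h₁ := ((isCompatible_whiskerRight_iff hc).2 h).comp_comp hac hbc δ γ
  obtain ⟨n, f, hf, e⟩ := hS.cocone_cells (d ◁ δ ≫ ((α_ d b c).inv ≫ α ▷ c) ≫ γ)
    ((α_ d b' c').inv ≫ α' ▷ c') hac
  have h₂ := (isCompatible_whiskerRight_iff hf).2 h₁
  rw [e] at h₂
  exact (isCompatible_whiskerRight_iff hc').1 ((isCompatible_whiskerRight_iff hf).1 h₂)

variable (p)

theorem exists_isCompatible (hS : IsSigmaFiltered S.mem) {i j : I} (d : i ⟶ j) :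
    ∃ φ : F.map d ≫ p.inclLeg j ⟶ p.inclLeg i, ∀ {l : I} {a : i ⟶ l} {b : j ⟶ l} (ha : S.mem a)
      (hb : S.mem b) (α : d ≫ b ⟶ a), p.IsCompatible φ ha hb α := by
  -- No 1-cell out of `j` is prescribed here, so the identity is extended; the marked 1-cell out of
  -- `j` is then `𝟙 j ≫ c`.
  obtain ⟨m, c, b, hc, hb, ⟨α⟩⟩ := hS.exists_extension d (𝟙 j)
  have h1c := S.comp_mem _ _ (S.id_mem j) hc
  obtain ⟨φ, hφ⟩ := pasteCell_left_surjective (d := d) (p.inclCell _ h1c)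
    (F.map₂ α ▷ p.inclLeg m ≫ p.inclCell b hb)
  have h : p.IsCompatible φ hb h1c α := hφ
  exact ⟨φ, fun ha hb α => h.change hS ha hb α⟩

/-- The extension to all 1-cells of the triangles of a pseudococone on the marked ones. -/
noncomputable def extCell (hS : IsSigmaFiltered S.mem) {i j : I} (d : i ⟶ j) :
    F.map d ≫ p.inclLeg j ⟶ p.inclLeg i :=
  (p.exists_isCompatible hS d).choose

theorem isCompatible_extCell (hS : IsSigmaFiltered S.mem) {i j l : I} {d : i ⟶ j} {a : i ⟶ l}
    {b : j ⟶ l} (ha : S.mem a) (hb : S.mem b) (α : d ≫ b ⟶ a) :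
    p.IsCompatible (p.extCell hS d) ha hb α :=
  (p.exists_isCompatible hS d).choose_spec ha hb α

theorem isCompatible_inclCell {i j l : I} {d : i ⟶ j} (hd : S.mem d) {a : i ⟶ l} {b : j ⟶ l}
    (ha : S.mem a) (hb : S.mem b) (α : d ≫ b ⟶ a) : p.IsCompatible (p.inclCell d hd) ha hb α := by
  rw [IsCompatible, ← p.inclCell_comp, p.inclCell_naturality]

theorem extCell_eq_of_isCompatible (hS : IsSigmaFiltered S.mem) {i j l : I} {d : i ⟶ j}
    {φ : F.map d ≫ p.inclLeg j ⟶ p.inclLeg i} {a : i ⟶ l} {b : j ⟶ l} {ha : S.mem a}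
    {hb : S.mem b} {α : d ≫ b ⟶ a} (h : p.IsCompatible φ ha hb α) : p.extCell hS d = φ :=
  (p.isCompatible_extCell hS ha hb α).unique h

theorem extCell_eq_inclCell (hS : IsSigmaFiltered S.mem) {i j : I} {d : i ⟶ j} (hd : S.mem d) :
    p.extCell hS d = p.inclCell d hd :=
  p.extCell_eq_of_isCompatible hS
    (p.isCompatible_inclCell hd (S.comp_mem _ _ hd (S.id_mem j)) (S.id_mem j) (𝟙 _))

/-- The `σ`-cocone extending a pseudococone on the marked arrows of a `σ`-filtered pair. -/
noncomputable def extend (hS : IsSigmaFiltered S.mem) : SigmaCocone F S.mem B where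
  leg := p.inclLeg
  cell d := p.extCell hS d
  cell_naturality {i j d e} α := by
    obtain ⟨m, c, b, hc, hb, ⟨β⟩⟩ := hS.exists_extension e (𝟙 j)
    have h1c := S.comp_mem _ _ (S.id_mem j) hc
    -- Preceding a comparison of `e` by `α` gives a comparison of `d`.
    refine (p.extCell_eq_of_isCompatible hS (ha := hb) (hb := h1c) (α := α ▷ _ ≫ β) ?_).symm
    rw [IsCompatible, ← map₂_whiskerRight_pasteCell_left, p.isCompatible_extCell hS hb h1c β]
    simp
  cell_id i := by rw [p.extCell_eq_inclCell hS (S.id_mem i), p.inclCell_id]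
  cell_comp {i j k} d e := by
    obtain ⟨l, b, a, hb, ha, ⟨α⟩⟩ := hS.exists_extension e (𝟙 k)
    -- Extending the marked `a` already chosen for `e` makes the two comparisons composable into one
    -- for `d ≫ e`.
    obtain ⟨m, c, a', hc, ha', ⟨β⟩⟩ := hS.exists_extension d a
    have hb' := S.comp_mem _ _ (S.id_mem k) hb
    have hbc := S.comp_mem _ _ hb' hc
    have hac := S.comp_mem _ _ ha hc
    refine p.extCell_eq_of_isCompatible hS (φ := pasteCell _ _) (ha := ha') (hb := hbc)
      (α := (α_ _ _ _).hom ≫ d ◁ ((α_ _ _ _).inv ≫ α ▷ c) ≫ β) ?_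
    rw [IsCompatible, ← map₂_associator_pasteCell,
      p.isCompatible_extCell hS hac hbc ((α_ _ _ _).inv ≫ α ▷ c),
      ← map₂_whiskerRight_pasteCell_right, p.isCompatible_extCell hS ha' hac β]
    simp only [F.map₂_comp, comp_whiskerRight, Category.assoc]
  isIso_cell d hd := by
    rw [p.extCell_eq_inclCell hS hd]
    infer_instance

end PseudoCocone

/-! ### Restriction of σ-cocones to the marked 1-cells is an equivalence -/

namespace SigmaCocone

/-- A family of invertible 2-cells compatible with the triangles is an isomorphism of
`σ`-cocones. -/
@[simps]
def isoMk {T : MorphismProperty I} {p q : SigmaCocone F T B} (e : ∀ i, p.leg i ≅ q.leg i)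
    (h : ∀ {i j : I} (d : i ⟶ j), F.map d ◁ (e j).hom ≫ q.cell d = p.cell d ≫ (e i).hom) :
    p ≅ q where
  hom :=
    { app i := (e i).hom
      naturality := h }
  inv :=
    { app i := (e i).inv
      naturality {i j} d := by
        rw [← cancel_epi (F.map d ◁ (e j).hom), whiskerLeft_hom_inv_assoc, reassoc_of% h d,
          Iso.hom_inv_id, Category.comp_id] }

/-- After pasting with the invertible triangle at a marked `b`, naturality at `d` becomes a
statement about the triangle at `d ≫ b`; a 2-cell `d ≫ b ⟶ a` with `a` marked reduces it to
naturality at `a` and `b`. -/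
theorem naturality_of_marked (hS : IsSigmaFiltered S.mem) {p q : SigmaCocone F S.mem B}
    (app : ∀ i, p.leg i ⟶ q.leg i)
    (h : ∀ {i j : I} (a : i ⟶ j), S.mem a → F.map a ◁ app j ≫ q.cell a = p.cell a ≫ app i)
    {i j : I} (d : i ⟶ j) : F.map d ◁ app j ≫ q.cell d = p.cell d ≫ app i := by
  obtain ⟨m, c, a, hc, ha, ⟨α⟩⟩ := hS.exists_extension d (𝟙 j)
  have hb := S.comp_mem _ _ (S.id_mem j) hc
  have := p.isIso_cell _ hb
  have hp := p.cell_comp d (𝟙 j ≫ c)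
  have hq := q.cell_comp d (𝟙 j ≫ c)
  refine pasteCell_left_injective (p.cell (𝟙 j ≫ c)) ?_
  dsimp only
  rw [pasteCell_whiskerLeft_comp, ← h _ hb, whiskerLeft_pasteCell, pasteCell_comp, pasteCell,
    pasteCell, ← hp, ← hq, ← p.cell_naturality α, ← q.cell_naturality α, Category.assoc, ← h _ ha,
    whisker_exchange_assoc]

variable (F S B) in
/-- Restriction of `σ`-cocones to pseudococones on the marked arrows. -/
@[simps]
def restrictIncl : SigmaCocone F S.mem B ⥤ PseudoCocone (S.incl.comp F) B where
  obj q := q.restrict S.incl ⊤ (fun _ _ d _ => Sub.Hom.mem d)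
  map m :=
    { app i := m.app i.obj
      naturality d := m.naturality d.hom }

/-- Faithfulness holds because objects are unchanged, fullness is `naturality_of_marked`, and
essential surjectivity is `extend`, whose triangles agree with the given ones at marked 1-cells. -/
theorem isEquivalence_restrictIncl (hS : IsSigmaFiltered S.mem) :
    (restrictIncl F S B).IsEquivalence where
  faithful := ⟨fun {_ _ m m'} h => by
    ext i
    exact congrArg (fun f => Hom.app f (⟨i⟩ : Sub S)) h⟩
  full := ⟨fun {p q} m =>
    ⟨{ app i := m.app ⟨i⟩
       naturality := naturality_of_marked hS _ fun {i j} a ha =>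
        m.naturality (i := ⟨i⟩) (j := ⟨j⟩) ⟨a, ha⟩ }, rfl⟩⟩
  essSurj := ⟨fun p => ⟨p.extend hS, ⟨
    isoMk (fun i => Iso.refl (p.leg i)) fun d => by
      have h : (p.extend hS).cell d.hom = p.cell d := p.extCell_eq_inclCell hS d.mem
      change F.map d.hom ◁ 𝟙 (p.leg _) ≫ p.cell d = (p.extend hS).cell d.hom ≫ 𝟙 (p.leg _)
      rw [h]
      exact (congrArg (· ≫ p.cell d) (Bicategory.whiskerLeft_id _ _)).trans
        ((Category.id_comp _).trans (Category.comp_id _).symm)⟩⟩⟩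

end SigmaCocone

end Extension

/-! ### Existence of `σ`-bicolimits of categories -/

section Presentation

variable {I : Type u} [Bicategory.{w, v} I] (F : I ⥤ᵖ Cat.{v₂, u₂})
  (S : MorphismProperty I)

/-- The objects of the `σ`-bicolimit of `F`: pairs of an object `i` and an object of `F(i)`. -/
structure Elt (F : I ⥤ᵖ Cat.{v₂, u₂}) (S : MorphismProperty I) :
    Type (max u u₂) where
  /-- The index. -/
  idx : I
  /-- The object over the index. -/
  pt : F.obj idx

/-- The generators of the morphisms of the `σ`-bicolimit of `F`. -/
inductive Gen : Elt F S → Elt F S → Type (max u v u₂ v₂)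
  | map {i : I} {x y : F.obj i} (f : x ⟶ y) : Gen ⟨i, x⟩ ⟨i, y⟩
  | cell {i j : I} (d : i ⟶ j) (x : F.obj i) : Gen ⟨j, (F.map d).toFunctor.obj x⟩ ⟨i, x⟩
  | inv {i j : I} (d : i ⟶ j) (hd : S d) (x : F.obj i) :
      Gen ⟨i, x⟩ ⟨j, (F.map d).toFunctor.obj x⟩

instance : Quiver (Elt F S) := ⟨Gen F S⟩

variable {F S} in
/-- A generator as a morphism of the category of paths. -/
abbrev Gen.path {X Y : Elt F S} (g : Gen F S X Y) :
    (Paths.of (Elt F S)).obj X ⟶ (Paths.of (Elt F S)).obj Y :=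
  (Paths.of (Elt F S)).map g

open Gen in
/-- The relations between the morphisms of the `σ`-bicolimit of `F`. -/
inductive Rel : HomRel (Paths (Elt F S))
  | map_id {i : I} (x : F.obj i) : Rel (map (𝟙 x)).path (𝟙 _)
  | map_comp {i : I} {x y z : F.obj i} (f : x ⟶ y) (g : y ⟶ z) :
      Rel (map (f ≫ g)).path ((map f).path ≫ (map g).path)
  | naturality {i j : I} (d : i ⟶ j) {x y : F.obj i} (f : x ⟶ y) :
      Rel ((map ((F.map d).toFunctor.map f)).path ≫ (cell d y).path)
        ((cell d x).path ≫ (map f).path)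
  | cell_naturality {i j : I} {d e : i ⟶ j} (α : d ⟶ e) (x : F.obj i) :
      Rel ((map ((F.map₂ α).toNatTrans.app x)).path ≫ (cell e x).path) (cell d x).path
  | cell_id {i : I} (x : F.obj i) :
      Rel (cell (𝟙 i) x).path (map ((F.mapId i).hom.toNatTrans.app x)).path
  | cell_comp {i j k : I} (d : i ⟶ j) (e : j ⟶ k) (x : F.obj i) :
      Rel (cell (d ≫ e) x).path ((map ((F.mapComp d e).hom.toNatTrans.app x)).path ≫
        (cell e ((F.map d).toFunctor.obj x)).path ≫ (cell d x).path)
  | cell_inv {i j : I} (d : i ⟶ j) (hd : S d) (x : F.obj i) :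
      Rel ((cell d x).path ≫ (inv d hd x).path) (𝟙 _)
  | inv_cell {i j : I} (d : i ⟶ j) (hd : S d) (x : F.obj i) :
      Rel ((inv d hd x).path ≫ (cell d x).path) (𝟙 _)

/-- The `σ`-bicolimit of `F`, presented by generators and relations. -/
abbrev Presented := Quotient (Rel F S)

variable {F S} in
/-- The class of a generator. -/
def Gen.hom {X Y : Elt F S} (g : Gen F S X Y) :
    (⟨X⟩ : Presented F S) ⟶ ⟨Y⟩ :=
  (Quotient.functor (Rel F S)).map g.path

variable {F S}

theorem Rel.map_eq {X Y : Paths (Elt F S)} {f g : X ⟶ Y} (h : Rel F S f g) :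
    (Quotient.functor (Rel F S)).map f = (Quotient.functor (Rel F S)).map g :=
  CategoryTheory.Quotient.sound _ h

/-- Every morphism is the class of a path, so naturality follows by induction on its length. -/
theorem Presented.naturality_of_gen {D : Type*} [Category* D] {G G' : Presented F S ⥤ D}
    (app : ∀ X : Presented F S, G.obj X ⟶ G'.obj X)
    (h : ∀ {X Y : Elt F S} (g : Gen F S X Y), G.map g.hom ≫ app ⟨Y⟩ = app ⟨X⟩ ≫ G'.map g.hom)
    {X Y : Presented F S} (f : X ⟶ Y) : G.map f ≫ app Y = app X ≫ G'.map f := by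
  induction f using Quotient.induction with
  | h f =>
  induction f using Paths.induction with
  | id =>
    erw [G.map_id, G'.map_id, Category.id_comp, Category.comp_id]
  | comp p q ih =>
    have := h q
    rw [Functor.map_comp, Functor.map_comp, Functor.map_comp, Category.assoc]
    erw [this, reassoc_of% ih]
    rfl

variable (F S) in
/-- The legs of the universal `σ`-cocone. -/
def Presented.leg (i : I) : F.obj i ⥤ Presented F S where
  obj x := ⟨⟨i, x⟩⟩
  map f := (Gen.map f).hom
  map_id x := (Rel.map_id x).map_eq
  map_comp f g := (Rel.map_comp f g).map_eq

variable (F S) in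
/-- The triangles of the universal `σ`-cocone. -/
def Presented.cell {i j : I} (d : i ⟶ j) :
    (F.map d).toFunctor ⋙ Presented.leg F S j ⟶ Presented.leg F S i where
  app x := (Gen.cell d x).hom
  naturality _ _ f := (Rel.naturality d f).map_eq

variable (F S) in
/-- The components of the universal triangle at a marked 1-cell are invertible. -/
def Presented.cellIso {i j : I} (d : i ⟶ j) (hd : S d) (x : F.obj i) :
    (⟨⟨j, (F.map d).toFunctor.obj x⟩⟩ : Presented F S) ≅ ⟨⟨i, x⟩⟩ where
  hom := (Gen.cell d x).hom
  inv := (Gen.inv d hd x).hom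
  hom_inv_id := (Rel.cell_inv d hd x).map_eq
  inv_hom_id := (Rel.inv_cell d hd x).map_eq

theorem Presented.isIso_cell {i j : I} (d : i ⟶ j) (hd : S d) :
    IsIso (Presented.cell F S d) :=
  have (x : F.obj i) : IsIso ((Presented.cell F S d).app x) := (cellIso F S d hd x).isIso_hom
  NatIso.isIso_of_isIso_app _

/-! ### Universal property of the presented category -/

section Lift

variable {B : Cat.{v₂, u₂}} (q : SigmaCocone F S B)

/-- The values of the functor induced by a `σ`-cocone on generators. -/
noncomputable def liftPrefunctor : Elt F S ⥤q B where
  obj X := (q.leg X.idx).toFunctor.obj X.pt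
  map
    | .map (i := i) f => (q.leg i).toFunctor.map f
    | .cell d x => (q.cell d).toNatTrans.app x
    | .inv d hd x =>
      have := q.isIso_cell d hd
      (inv (q.cell d)).toNatTrans.app x

theorem lift_path {X Y : Elt F S} (g : Gen F S X Y) :
    (Paths.lift (liftPrefunctor q)).map g.path = (liftPrefunctor q).map g :=
  Paths.lift_toPath _ _

theorem lift_rel {X Y : Paths (Elt F S)} {f g : X ⟶ Y} (h : Rel F S f g) :
    (Paths.lift (liftPrefunctor q)).map f = (Paths.lift (liftPrefunctor q)).map g := by
  cases h with
  | map_id x =>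
    rw [lift_path]
    exact (q.leg _).toFunctor.map_id x
  | map_comp f g =>
    rw [Functor.map_comp, lift_path, lift_path, lift_path]
    exact (q.leg _).toFunctor.map_comp f g
  | naturality d f =>
    rw [Functor.map_comp, Functor.map_comp, lift_path, lift_path, lift_path, lift_path]
    exact (q.cell d).toNatTrans.naturality f
  | cell_naturality α x =>
    rw [Functor.map_comp, lift_path, lift_path, lift_path]
    exact congr($(q.cell_naturality α).toNatTrans.app x)
  | cell_id x =>
    rw [lift_path, lift_path]
    -- Unitors and associators of `Cat` have identity components, which have to be absorbed here and
    -- in similar steps below.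
    exact congr($(q.cell_id _).toNatTrans.app x).trans (Category.comp_id _)
  | cell_comp d e x =>
    rw [Functor.map_comp, Functor.map_comp, lift_path, lift_path, lift_path, lift_path]
    exact congr($(q.cell_comp d e).toNatTrans.app x).trans
      (congrArg _ (Category.id_comp _))
  | cell_inv d hd x =>
    have := q.isIso_cell d hd
    rw [Functor.map_comp, lift_path, lift_path]
    exact congr($(IsIso.hom_inv_id (q.cell d)).toNatTrans.app x)
  | inv_cell d hd x =>
    have := q.isIso_cell d hd
    rw [Functor.map_comp, lift_path, lift_path]
    exact congr($(IsIso.inv_hom_id (q.cell d)).toNatTrans.app x)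

/-- The functor out of the presented category induced by a `σ`-cocone. -/
noncomputable def Presented.lift : Presented F S ⥤ B :=
  CategoryTheory.Quotient.lift _ (Paths.lift (liftPrefunctor q)) fun _ _ _ _ h => lift_rel q h

theorem Presented.lift_hom {X Y : Elt F S} (g : Gen F S X Y) :
    (Presented.lift q).map g.hom = (liftPrefunctor q).map g :=
  lift_path q g

end Lift

/-- The universal `σ`-cocone. -/
def Presented.cocone (F : I ⥤ᵖ Cat.{max u v t, max u v t}) (S : MorphismProperty I) :
    SigmaCocone F S (Cat.of (Presented F S)) where
  leg i := ⟨Presented.leg F S i⟩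
  cell d := ⟨Presented.cell F S d⟩
  cell_naturality α := by
    ext x
    exact (Rel.cell_naturality α x).map_eq
  cell_id i := by
    ext x
    refine (Rel.cell_id x).map_eq.trans (Category.comp_id _).symm
  cell_comp d e := by
    ext x
    refine (Rel.cell_comp d e x).map_eq.trans ?_
    exact congrArg _ (Category.id_comp _).symm
  isIso_cell d hd :=
    have := Presented.isIso_cell (F := F) d hd
    (Cat.Hom.isoMk (asIso (Presented.cell F S d))).isIso_hom

variable (F : I ⥤ᵖ Cat.{max u v t, max u v t}) (S : MorphismProperty I)

/-- The relations are exactly the axioms of a σ-cocone. The 2-cells of `I` enter only through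
relations, so `max u v t` bounds both objects and morphisms and the tip lies in the same `Cat` as
the values of `F`. -/
theorem Presented.isSigmaBicolimit_cocone :
    (Presented.cocone.{w, v, u, t} F S).IsSigmaBicolimit := fun B =>
  { faithful := ⟨fun {G G' m m'} h => by
      ext X
      exact congr($(congrArg (fun f => SigmaCocone.Hom.app f X.as.idx) h).toNatTrans.app X.as.pt)⟩
    full := ⟨fun {G G'} m => by
      have key {i j : I} (d : i ⟶ j) (x : F.obj i) :
          (m.app j).toNatTrans.app ((F.map d).toFunctor.obj x) ≫
            G'.toFunctor.map (Gen.cell (S := S) d x).hom =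
          G.toFunctor.map (Gen.cell (S := S) d x).hom ≫ (m.app i).toNatTrans.app x := by
        exact (congrArg _ (Category.id_comp _).symm).trans
          (congr($(m.naturality d).toNatTrans.app x).trans
            (congrArg (· ≫ _) (Category.id_comp _)))
      refine ⟨⟨{ app X := (m.app X.as.idx).toNatTrans.app X.as.pt, naturality := ?_ }⟩, ?_⟩
      · intro X Y f
        refine Presented.naturality_of_gen (fun X => (m.app X.as.idx).toNatTrans.app X.as.pt) ?_ f
        rintro _ _ (f | ⟨d, x⟩ | ⟨d, hd, x⟩)
        · exact (m.app _).toNatTrans.naturality f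
        · exact (key d x).symm
        -- Naturality at a formal inverse is naturality at the triangle itself, with the isomorphism
        -- moved to the other side.
        · let e := Presented.cellIso F S d hd x
          exact (Iso.inv_comp_eq (G.toFunctor.mapIso e)).2
            (((Iso.eq_comp_inv (G'.toFunctor.mapIso e)).2 (key d x)).trans (Category.assoc _ _ _))
      · rfl⟩
    essSurj := ⟨fun p => ⟨⟨Presented.lift p⟩, ⟨
      SigmaCocone.isoMk (fun i => Cat.Hom.isoMk (NatIso.ofComponents (fun x => Iso.refl _)
          fun f => by
            refine (Category.comp_id _).trans (Eq.trans ?_ (Category.id_comp _).symm)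
            exact Presented.lift_hom p (Gen.map f))) fun {i j} d => by
        ext x
        refine (Category.id_comp _).trans (Eq.trans ?_ (Category.comp_id _).symm)
        exact ((Category.id_comp _).trans (Presented.lift_hom p (Gen.cell d x))).symm⟩⟩⟩ }

end Presentation

/-! ### Comparison of bicolimits -/

section Comparison

variable {I : Type u} [Bicategory.{w, v} I]

namespace SigmaCocone

section

variable {C : Type u₂} [Bicategory.{w₂, v₂} C] {F : I ⥤ᵖ C} {S : SigmaClass I} {L : C}

/-- Over a `σ`-filtered pair, a `σ`-bicolimit restricts to a bicolimit on the marked arrows. -/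
theorem IsSigmaBicolimit.restrict (hS : IsSigmaFiltered S.mem) {q : SigmaCocone F S.mem L}
    (hq : q.IsSigmaBicolimit) : ((restrictIncl F S L).obj q).IsSigmaBicolimit := fun B =>
  have := hq B
  have := isEquivalence_restrictIncl (F := F) (B := B) hS
  -- Whiskering commutes with restriction definitionally, so the functor in question is a composite
  -- of two equivalences.
  inferInstanceAs (q.whiskerFunctor B ⋙ restrictIncl F S B).IsEquivalence

variable {T : MorphismProperty I}

/-- Whiskering along a composite, up to the associator. -/
def whiskerComp {L M B : C} (r : SigmaCocone F T M) (G : M ⟶ L) (H : L ⟶ B) :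
    (r.whisker G).whisker H ≅ r.whisker (G ≫ H) :=
  isoMk (fun i => α_ (r.leg i) G H) fun d => by simp

/-- Whiskering an isomorphism of `σ`-cocones. -/
def whiskerIso {L B : C} {p q : SigmaCocone F T L} (e : p ≅ q) (H : L ⟶ B) :
    p.whisker H ≅ q.whisker H :=
  isoMk (fun i => whiskerRightIso
      ⟨e.hom.app i, e.inv.app i, congrArg (fun m => Hom.app m i) e.hom_inv_id,
        congrArg (fun m => Hom.app m i) e.inv_hom_id⟩ H) fun d => by
    have := e.hom.naturality d
    simp only [whisker, whiskerRightIso_hom, whisker_assoc_symm, Category.assoc,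
      Iso.hom_inv_id_assoc, ← comp_whiskerRight, this]

/-- A 1-cell between `σ`-bicolimits compatible with the universal `σ`-cocones is an equivalence on
hom-categories. -/
theorem IsSigmaBicolimit.isEquivalence_precomp {L M : C} {r : SigmaCocone F T M}
    {q : SigmaCocone F T L} (hr : r.IsSigmaBicolimit) (hq : q.IsSigmaBicolimit) (G : M ⟶ L)
    (e : r.whisker G ≅ q) (B : C) : (precomp B G).IsEquivalence := by
  -- Whiskering with `r` after precomposing with `G` is whiskering with `q` up to isomorphism;
  -- two-out-of-three then applies.
  let τ : precomp B G ⋙ r.whiskerFunctor B ≅ q.whiskerFunctor B :=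
    NatIso.ofComponents (fun H => (whiskerComp r G H).symm ≪≫ whiskerIso e H) fun β => by
      ext i
      change r.leg i ◁ G ◁ _ ≫ (α_ (r.leg i) G _).inv ≫ e.hom.app i ▷ _ =
        ((α_ (r.leg i) G _).inv ≫ e.hom.app i ▷ _) ≫ q.leg i ◁ _
      rw [Category.assoc, ← whisker_exchange, associator_inv_naturality_right_assoc]
  have := hr B
  have := hq B
  have := Functor.isEquivalence_of_iso τ.symm
  exact Functor.isEquivalence_of_comp_right _ (r.whiskerFunctor B)

end

end SigmaCocone

/-- Yoneda: essential surjectivity at `B = M` yields `H` with `G ≫ H ≅ 𝟙 M`, and full faithfulness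
at `B = L` reflects `G ≫ H ≫ G ≅ G` to `H ≫ G ≅ 𝟙 L`. -/
theorem isEquivalence_of_precomp {L M : Cat.{v₂, u₂}} (G : M ⟶ L)
    (h : ∀ B : Cat.{v₂, u₂}, (precomp B G).IsEquivalence) : G.toFunctor.IsEquivalence := by
  have := h M
  have := h L
  let H := (precomp M G).objPreimage (𝟙 M)
  let κ : G ≫ H ≅ 𝟙 M := (precomp M G).objObjPreimageIso (𝟙 M)
  let ν : H ≫ G ≅ 𝟙 L := (precomp L G).preimageIso
    ((α_ G H G).symm ≪≫ whiskerRightIso κ G ≪≫ λ_ G ≪≫ (ρ_ G).symm)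
  exact (CategoryTheory.Equivalence.mk G.toFunctor H.toFunctor (Cat.Hom.toNatIso κ.symm)
    (Cat.Hom.toNatIso ν)).isEquivalence_functor


end Comparison

end SigmaTwoCat

theorem mainTheorem8 {I : Type u} [Bicategory.{w, v} I] [Bicategory.Strict I]
    (S : SigmaTwoCat.SigmaClass I) :
    (SigmaTwoCat.IsSigmaFiltered S.mem ↔
      SigmaTwoCat.IsBifiltered (SigmaTwoCat.Sub S) ∧
        SigmaTwoCat.IsSigmaCofinal S.incl ⊤ S.mem) ∧
    (SigmaTwoCat.IsSigmaFiltered S.mem →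
      ∀ F : I ⥤ᵖ Cat.{max u v t, max u v t},
        (∃ (L : Cat.{max u v t, max u v t}) (q : SigmaTwoCat.SigmaCocone F S.mem L),
          q.IsSigmaBicolimit) ∧
        (∃ (M : Cat.{max u v t, max u v t}) (r : SigmaTwoCat.PseudoCocone (S.incl.comp F) M),
          r.IsBicolimit) ∧
        ∀ (L M : Cat.{max u v t, max u v t}) (q : SigmaTwoCat.SigmaCocone F S.mem L)
          (r : SigmaTwoCat.PseudoCocone (S.incl.comp F) M),
          q.IsSigmaBicolimit → r.IsBicolimit →
            ∃ G : M ⟶ L, G.toFunctor.IsEquivalence ∧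
              Nonempty (r.whisker G ≅ q.restrict S.incl ⊤ (fun _ _ d _ => SigmaTwoCat.Sub.Hom.mem d))) := by
  refine ⟨SigmaTwoCat.isSigmaFiltered_iff, fun hS F => ?_⟩
  have hq := SigmaTwoCat.Presented.isSigmaBicolimit_cocone.{w, v, u, t} F S.mem
  refine ⟨⟨_, _, hq⟩, ⟨_, _, hq.restrict hS⟩, fun L M q r hq hr => ?_⟩
  -- The comparison 1-cell comes from essential surjectivity of whiskering with `r`, applied to the
  -- restriction of `q`.
  have := hr L
  let q' := (SigmaTwoCat.SigmaCocone.restrictIncl F S L).obj q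
  let e : r.whisker ((r.whiskerFunctor L).objPreimage q') ≅ q' :=
    (r.whiskerFunctor L).objObjPreimageIso q'
  exact ⟨_, SigmaTwoCat.isEquivalence_of_precomp _
    (hr.isEquivalence_precomp (hq.restrict hS) _ e), ⟨e⟩⟩
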